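/- For a partition $\lambda$, let $f^\lambda$ denote the number of standard Young tableaux of shape $\lambda$. For integers $k,\ell,n\ge 0$ let $$S(k,\ell;n)=\sum_{\lambda\vdash n,\ \lambda_{k+1}\le \ell} f^\lambda ,$$ and let $C_j=\frac1{j+1}\binom{2j}{j}$ be the Catalan numbers. For $m\ge 2$ let $S^*(2,2;2m)=\sum_\lambda f^\lambda$, summed over the set of partitions $\lambda=(k+2,k+2,2^{m-2-k})\vdash 2m$ with $0\le k\le m-2$, and let $S^*(2,2;2m+1)=\sum_\lambda f^\lambda$, summed over the set of partitions $\lambda=(k+3,k+2,2^{m-2-k})\vdash 2m+1$ with $0\le k\le m-2$. (Here $2^{r}$ stands for $r$ parts equal to $2$.) Then, for every integer $m\ge 2$: 1. $S(4,0;2m-2)=C_{m-1}\,C_m=S^*(2,2;2m)$, and explicitly $$C_{m-1}C_m=\frac{1}{m(m+1)}\binom{2m-2}{m-1}\binom{2m}{m}=\sum_{k=0}^{m-2}\frac{(2m)!}{k!\,(k+1)!\,(m-k-2)!\,(m-k-1)!\,(m-1)\,m^2\,(m+1)}.$$ 2. $\frac{2m+1}{m+2}\,S(4,0;2m-1)=\frac{2m+1}{m+2}\,C_m^2=S^*(2,2;2m+1)$,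 and explicitly $$\frac{2m+1}{m+2}\,C_m^2=\frac{1}{(m+1)(m+2)}\binom{2m}{m}\binom{2m+1}{m}=\sum_{k=0}^{m-2}\frac{2\,(2m+1)!}{k!\,(k+2)!\,(m-k-2)!\,(m-k-1)!\,(m-1)\,m\,(m+1)\,(m+2)}.$$ -/

import Mathlib

open scoped Nat

namespace HookSums

/-- A tableau of shape `μ` is standard if it contains each of the numbers `1, …, |μ|` exactly once.
(Rows of a `SemistandardYoungTableau` increase weakly and columns strictly; as the entries are
distinct, the rows then increase strictly too.) -/
def IsStandard {μ : YoungDiagram} (T : SemistandardYoungTableau μ) : Prop :=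
  Set.BijOn (fun c : ℕ × ℕ => T c.1 c.2) (μ : Set (ℕ × ℕ)) (Set.Icc 1 μ.card)

/-- There are finitely many standard Young tableaux of a given shape. -/
theorem finite_isStandard (μ : YoungDiagram) :
    Finite {T : SemistandardYoungTableau μ // IsStandard T} := by
  let F : {T : SemistandardYoungTableau μ // IsStandard T} →
      (μ.cells → Fin (μ.card + 1)) := fun T c =>
    ⟨T.1 c.1.1 c.1.2, Nat.lt_succ_of_le (T.2.mapsTo c.2).2⟩
  refine Finite.of_injective F ?_
  intro T T' h
  apply Subtype.ext
  apply SemistandardYoungTableau.ext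
  intro i j
  by_cases hij : (i, j) ∈ μ
  · have := congrFun h ⟨(i, j), hij⟩
    simpa [F] using this
  · rw [T.1.zeros hij, T'.1.zeros hij]

/-- `f^μ`, the number of standard Young tableaux of shape `μ` (a finite number by
`finite_isStandard`). -/
noncomputable def numSYT (μ : YoungDiagram) : ℕ :=
  Nat.card {T : SemistandardYoungTableau μ // IsStandard T}

/-- `H(k, ℓ; n)`: the partitions `λ` of `n`, as Young diagrams, with `λ_{k+1} ≤ ℓ`
(rows are numbered from `0` in `YoungDiagram.rowLen`). -/
def hook (k l n : ℕ) : Set YoungDiagram :=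
  {μ | μ.card = n ∧ μ.rowLen k ≤ l}

theorem hook_finite (k l n : ℕ) : (hook k l n).Finite := by
  refine Set.Finite.of_injOn (f := YoungDiagram.cells)
    (t := ((Finset.range n ×ˢ Finset.range n).powerset : Set (Finset (ℕ × ℕ)))) ?_ ?_
    (Finset.finite_toSet _)
  · rintro μ ⟨hμ, -⟩
    simp only [Finset.coe_powerset, Set.mem_preimage, Set.mem_powerset_iff, Finset.coe_subset]
    rintro ⟨i, j⟩ hc
    have h1 : (Finset.range (i + 1)).image (fun a => (a, j)) ⊆ μ.cells := by
      intro c hc'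
      obtain ⟨a, ha, rfl⟩ := Finset.mem_image.1 hc'
      exact μ.up_left_mem (Nat.lt_succ_iff.1 (Finset.mem_range.1 ha)) le_rfl hc
    have h2 : (Finset.range (j + 1)).image (fun a => (i, a)) ⊆ μ.cells := by
      intro c hc'
      obtain ⟨a, ha, rfl⟩ := Finset.mem_image.1 hc'
      exact μ.up_left_mem le_rfl (Nat.lt_succ_iff.1 (Finset.mem_range.1 ha)) hc
    have h1' := Finset.card_le_card h1
    have h2' := Finset.card_le_card h2
    rw [Finset.card_image_of_injective _ (fun a b h => congrArg Prod.fst h),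
      Finset.card_range] at h1'
    rw [Finset.card_image_of_injective _ (fun a b h => congrArg Prod.snd h),
      Finset.card_range] at h2'
    have hμ' : μ.cells.card = n := hμ
    simp only [Finset.mem_product, Finset.mem_range]
    omega
  · intro μ _ ν _ h
    exact YoungDiagram.ext h

/-- `S(k, ℓ; n)`: the sum of `f^λ` over `λ ∈ H(k, ℓ; n)`. -/
noncomputable def S (k l n : ℕ) : ℕ :=
  ∑ μ ∈ (hook_finite k l n).toFinset, numSYT μ

theorem sortedGE_even (m k : ℕ) :
    ((k + 2) :: (k + 2) :: List.replicate (m - 2 - k) 2).SortedGE := by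
  rw [List.sortedGE_iff_pairwise]
  simp

theorem sortedGE_odd (m k : ℕ) :
    ((k + 3) :: (k + 2) :: List.replicate (m - 2 - k) 2).SortedGE := by
  rw [List.sortedGE_iff_pairwise]
  simp

/-- The shape `(k+2, k+2, 2^{m-2-k})`, a partition of `2m` when `k + 2 ≤ m`. -/
def shapeEven (m k : ℕ) : YoungDiagram :=
  YoungDiagram.ofRowLens _ (sortedGE_even m k)

/-- The shape `(k+3, k+2, 2^{m-2-k})`, a partition of `2m+1` when `k + 2 ≤ m`. -/
def shapeOdd (m k : ℕ) : YoungDiagram :=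
  YoungDiagram.ofRowLens _ (sortedGE_odd m k)

open scoped Classical in
/-- `H^*(2, 2; n)` for `n = 2m` or `n = 2m + 1`, `m ≥ 2`: the set of the shapes
`(k+2, k+2, 2^{m-2-k})`, respectively `(k+3, k+2, 2^{m-2-k})`, for `k = 0, …, m - 2`. -/
noncomputable def hookStar (n : ℕ) : Finset YoungDiagram :=
  if Even n then (Finset.range (n / 2 - 1)).image (shapeEven (n / 2))
  else (Finset.range (n / 2 - 1)).image (shapeOdd (n / 2))

/-- `S^*(2, 2; n)`: the sum of `f^λ` over `λ ∈ H^*(2, 2; n)`. -/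
noncomputable def SStar (n : ℕ) : ℕ :=
  ∑ μ ∈ hookStar n, numSYT μ

end HookSums

/-!
Both sides are computed from the branching rule `f^μ = ∑ f^(μ - c)`, the sum over the corners `c`
of `μ` (`numSYT_eq_sum_corners`): delete the largest entry of a standard tableau.

*At most four rows.* A standard tableau with at most four rows is a walk with steps `e₁, …, e₄` that
starts at `(3, 2, 1, 0)` and keeps its coordinates strictly decreasing. The exponential generating
function of such walks with free end point is the Pfaffian of the matrix `(E_{v_i - v_j})`, where
`v` is the starting point and `E_d = ∑_{-d < s ≤ d} I_s(2x)`. This needs no reflection argument: the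
Pfaffian satisfies the first-step recursion (`derivative_chamberSeries`), vanishes when two
adjacent coordinates agree, and has constant term `1` inside the chamber. A double counting along
the branching rule (`sum_numSYT_mul_extensions_succ`) then identifies `S(4, 0; n)` with `n!` times
its coefficient at the starting point `(3, 2, 1, 0)` (`S_four_zero`). There the Pfaffian is a
quadratic form in `I₀` and `I₁` (`X_mul_chamberSeries_one`), and Vandermonde's identity gives the
coefficients of `I₀²`, `I₀I₁` and `I₁²`, hence the products of Catalan numbers.

*Double hooks.* For the shapes `(a + 2, b + 2, 2^p, 1^q)` the value of the hook length formula
satisfies the branching rule (`doubleHookCount_eq_sum`), so it equals `f^λ`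
(`numSYT_of_doubleHookRow`); this four-parameter family is closed under removing corners up to
ordinary hooks, for which `f^λ` is a binomial coefficient. The shapes in `S^*(2, 2; n)` are the case
`q = 0`, `a - b ∈ {0, 1}`, and the resulting sums are Vandermonde sums
(`sum_range_one_div_factorial`).
-/

namespace HookSums

/-! ### Removing a corner from a standard tableau -/

/-- A cell of `μ` with no cell of `μ` directly below it or directly to its right. -/
def IsCorner (μ : YoungDiagram) (c : ℕ × ℕ) : Prop :=
  c ∈ μ ∧ (c.1 + 1, c.2) ∉ μ ∧ (c.1, c.2 + 1) ∉ μ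

open scoped Classical in
/-- The finite set of corners of `μ`. -/
noncomputable def corners (μ : YoungDiagram) : Finset (ℕ × ℕ) :=
  μ.cells.filter (IsCorner μ)

theorem mem_corners {μ : YoungDiagram} {c : ℕ × ℕ} : c ∈ corners μ ↔ IsCorner μ c := by
  classical
  simp only [corners, Finset.mem_filter, YoungDiagram.mem_cells, and_iff_right_iff_imp]
  exact fun h => h.1

/-- `μ` without the cells weakly south-east of `c`. This is a Young diagram for every `c`; for a
corner `c` it is `μ` without `c`. -/
def removeCell (μ : YoungDiagram) (c : ℕ × ℕ) : YoungDiagram where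
  cells := μ.cells.filter fun d => ¬ c ≤ d
  isLowerSet := by
    intro d e hed hd
    simp only [Finset.coe_filter, YoungDiagram.mem_cells, Set.mem_ofPred_eq] at hd ⊢
    exact ⟨μ.isLowerSet hed hd.1, fun h => hd.2 (h.trans hed)⟩

theorem IsCorner.eq_of_le {μ : YoungDiagram} {c d : ℕ × ℕ} (hc : IsCorner μ c) (hd : d ∈ μ)
    (h : c ≤ d) : d = c := by
  obtain ⟨i, j⟩ := c
  obtain ⟨a, b⟩ := d
  obtain ⟨h1, h2⟩ := Prod.mk_le_mk.1 h
  by_contra hne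
  rcases Nat.lt_or_ge i a with hia | hia
  · exact hc.2.1 (μ.up_left_mem hia h2 hd)
  · rcases Nat.lt_or_ge j b with hjb | hjb
    · exact hc.2.2 (μ.up_left_mem h1 hjb hd)
    · exact hne (by rw [le_antisymm h1 hia, le_antisymm h2 hjb])

theorem IsCorner.mem_removeCell {μ : YoungDiagram} {c : ℕ × ℕ} (hc : IsCorner μ c) {d : ℕ × ℕ} :
    d ∈ removeCell μ c ↔ d ∈ μ ∧ d ≠ c := by
  rw [← YoungDiagram.mem_cells, removeCell, Finset.mem_filter, YoungDiagram.mem_cells]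
  refine and_congr_right fun hd => not_congr ⟨hc.eq_of_le hd, ?_⟩
  rintro rfl
  exact le_rfl

theorem IsCorner.removeCell_cells {μ : YoungDiagram} {c : ℕ × ℕ} (hc : IsCorner μ c) :
    (removeCell μ c).cells = μ.cells.erase c := by
  ext d
  rw [YoungDiagram.mem_cells, hc.mem_removeCell, Finset.mem_erase, YoungDiagram.mem_cells, and_comm]

theorem IsCorner.card_removeCell {μ : YoungDiagram} {c : ℕ × ℕ} (hc : IsCorner μ c) :
    (removeCell μ c).card + 1 = μ.card := by
  rw [YoungDiagram.card, hc.removeCell_cells]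
  exact Finset.card_erase_add_one ((YoungDiagram.mem_cells _).2 hc.1)

/-- The tableau of shape `μ` obtained from a standard tableau on `μ` without the corner `c` by
writing the largest entry `|μ|` into `c`. -/
def insertMax {μ : YoungDiagram} {c : ℕ × ℕ} (hc : IsCorner μ c)
    (T : SemistandardYoungTableau (removeCell μ c)) (hT : IsStandard T) :
    SemistandardYoungTableau μ where
  entry i j := if (i, j) = c then μ.card else T i j
  row_weak' := by
    intro i j₁ j₂ hj hm
    have hm₁ := μ.up_left_mem le_rfl hj.le hm
    have h1 : (i, j₁) ≠ c := by
      rintro rfl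
      exact hc.2.2 (μ.up_left_mem le_rfl hj hm)
    rw [if_neg h1]
    split_ifs with h2
    · have := (hT.mapsTo (hc.mem_removeCell.2 ⟨hm₁, h1⟩)).2
      have h := hc.card_removeCell
      simp only at this
      omega
    · exact T.row_weak hj (hc.mem_removeCell.2 ⟨hm, h2⟩)
  col_strict' := by
    intro i₁ i₂ j hi hm
    have hm₁ := μ.up_left_mem hi.le le_rfl hm
    have h1 : (i₁, j) ≠ c := by
      rintro rfl
      exact hc.2.1 (μ.up_left_mem hi le_rfl hm)
    rw [if_neg h1]
    split_ifs with h2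
    · have := (hT.mapsTo (hc.mem_removeCell.2 ⟨hm₁, h1⟩)).2
      have h := hc.card_removeCell
      simp only at this
      omega
    · exact T.col_strict hi (hc.mem_removeCell.2 ⟨hm, h2⟩)
  zeros' := by
    intro i j hm
    rw [if_neg (by rintro rfl; exact hm hc.1)]
    exact T.zeros fun h => hm (hc.mem_removeCell.1 h).1

theorem insertMax_apply {μ : YoungDiagram} {c : ℕ × ℕ} (hc : IsCorner μ c)
    (T : SemistandardYoungTableau (removeCell μ c)) (hT : IsStandard T) (i j : ℕ) :
    insertMax hc T hT i j = if (i, j) = c then μ.card else T i j := rfl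

theorem isStandard_insertMax {μ : YoungDiagram} {c : ℕ × ℕ} (hc : IsCorner μ c)
    (T : SemistandardYoungTableau (removeCell μ c)) (hT : IsStandard T) :
    IsStandard (insertMax hc T hT) := by
  have hcard := hc.card_removeCell
  refine ⟨?_, ?_, ?_⟩
  · rintro ⟨i, j⟩ hm
    simp only [insertMax_apply]
    split_ifs with h
    · exact ⟨by omega, le_rfl⟩
    · have := hT.mapsTo (hc.mem_removeCell.2 ⟨hm, h⟩)
      exact ⟨this.1, this.2.trans (by omega)⟩
  · rintro ⟨i, j⟩ hm ⟨i', j'⟩ hm' h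
    simp only [insertMax_apply] at h
    split_ifs at h with h1 h2 h2
    · rw [h1, h2]
    · have := (hT.mapsTo (hc.mem_removeCell.2 ⟨hm', h2⟩)).2
      simp only at this
      omega
    · have := (hT.mapsTo (hc.mem_removeCell.2 ⟨hm, h1⟩)).2
      simp only at this
      omega
    · exact hT.injOn (hc.mem_removeCell.2 ⟨hm, h1⟩) (hc.mem_removeCell.2 ⟨hm', h2⟩) h
  · rintro v ⟨hv1, hv2⟩
    rcases eq_or_lt_of_le hv2 with rfl | hv
    · exact ⟨c, hc.1, by simp [insertMax_apply]⟩
    · obtain ⟨⟨i, j⟩, hd, hdv⟩ := hT.surjOn (show v ∈ Set.Icc 1 _ from ⟨hv1, by omega⟩)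
      have hd' := hc.mem_removeCell.1 hd
      exact ⟨(i, j), hd'.1, by simpa [insertMax_apply, hd'.2] using hdv⟩

/-- The largest entry of a standard tableau sits in a corner. -/
theorem IsStandard.exists_isCorner {μ : YoungDiagram} {T : SemistandardYoungTableau μ}
    (hT : IsStandard T) (h0 : μ.card ≠ 0) : ∃ c, IsCorner μ c ∧ T c.1 c.2 = μ.card := by
  obtain ⟨⟨i, j⟩, hm, h⟩ := hT.surjOn
    (show μ.card ∈ Set.Icc 1 _ from ⟨Nat.one_le_iff_ne_zero.2 h0, le_rfl⟩)
  simp only at h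
  refine ⟨(i, j), ⟨hm, fun hd => ?_, fun hd => ?_⟩, h⟩
  · have h1 : T i j < T (i + 1) j := T.col_strict (Nat.lt_succ_self i) hd
    have h2 := (hT.mapsTo hd).2
    simp only at h2
    omega
  · have h1 : T i j ≤ T i (j + 1) := T.row_weak (Nat.lt_succ_self j) hd
    have h2 := (hT.mapsTo hd).2
    have h3 := hT.injOn hm hd (by simp only at h2 ⊢; omega)
    simp at h3

/-- The tableau on `μ` without the corner `c` obtained by restricting a tableau on `μ`. -/
def restrict {μ : YoungDiagram} {c : ℕ × ℕ} (hc : IsCorner μ c) (T : SemistandardYoungTableau μ) :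
    SemistandardYoungTableau (removeCell μ c) where
  entry i j := if (i, j) = c then 0 else T i j
  row_weak' := by
    intro i j₁ j₂ hj hm
    have hm' := hc.mem_removeCell.1 hm
    rw [if_neg hm'.2]
    split_ifs with h
    · exact Nat.zero_le _
    · exact T.row_weak hj hm'.1
  col_strict' := by
    intro i₁ i₂ j hi hm
    have hm' := hc.mem_removeCell.1 hm
    have h1 := hc.mem_removeCell.1 ((removeCell μ c).up_left_mem hi.le le_rfl hm)
    rw [if_neg hm'.2, if_neg h1.2]
    exact T.col_strict hi hm'.1
  zeros' := by
    intro i j hm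
    split_ifs with h
    · rfl
    · exact T.zeros fun h' => hm (hc.mem_removeCell.2 ⟨h', h⟩)

theorem restrict_apply {μ : YoungDiagram} {c : ℕ × ℕ} (hc : IsCorner μ c)
    (T : SemistandardYoungTableau μ) (i j : ℕ) :
    restrict hc T i j = if (i, j) = c then 0 else T i j := rfl

theorem isStandard_restrict {μ : YoungDiagram} {c : ℕ × ℕ} (hc : IsCorner μ c)
    {T : SemistandardYoungTableau μ} (hT : IsStandard T) (hmax : T c.1 c.2 = μ.card) :
    IsStandard (restrict hc T) := by
  have hcard := hc.card_removeCell
  refine ⟨?_, ?_, ?_⟩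
  · rintro ⟨i, j⟩ hm
    obtain ⟨hm, h⟩ := hc.mem_removeCell.1 hm
    simp only [restrict_apply, if_neg h]
    have h1 := hT.mapsTo hm
    refine ⟨h1.1, ?_⟩
    have h2 : T i j ≠ μ.card := fun h2 => h (hT.injOn hm hc.1 (by simpa using h2.trans hmax.symm))
    have h3 : T i j ≤ μ.card := h1.2
    omega
  · rintro ⟨i, j⟩ hm ⟨i', j'⟩ hm' h
    obtain ⟨hm, h1⟩ := hc.mem_removeCell.1 hm
    obtain ⟨hm', h2⟩ := hc.mem_removeCell.1 hm'
    simp only [restrict_apply, if_neg h1, if_neg h2] at h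
    exact hT.injOn hm hm' h
  · rintro v ⟨hv1, hv2⟩
    obtain ⟨⟨i, j⟩, hd, hdv⟩ := hT.surjOn (show v ∈ Set.Icc 1 _ from ⟨hv1, by omega⟩)
    have hne : (i, j) ≠ c := by
      rintro rfl
      simp only at hdv hmax
      omega
    exact ⟨(i, j), hc.mem_removeCell.2 ⟨hd, hne⟩, by simpa [restrict_apply, hne] using hdv⟩

/-- The branching rule `f^μ = ∑ f^(μ - c)`, over the corners `c` of `μ`: delete the largest entry of
a standard tableau. -/
theorem numSYT_eq_sum_corners {μ : YoungDiagram} (h0 : μ.card ≠ 0) :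
    numSYT μ = ∑ c ∈ corners μ, numSYT (removeCell μ c) := by
  let F : (Σ c : corners μ, {T : SemistandardYoungTableau (removeCell μ c.1) // IsStandard T}) →
      {T : SemistandardYoungTableau μ // IsStandard T} := fun x =>
    ⟨insertMax (mem_corners.1 x.1.2) x.2.1 x.2.2, isStandard_insertMax _ _ _⟩
  have hF : Function.Bijective F := by
    constructor
    · rintro ⟨⟨c, hc⟩, T, hT⟩ ⟨⟨c', hc'⟩, T', hT'⟩ h
      have hc1 := mem_corners.1 hc
      have hc2 := mem_corners.1 hc'
      have h' : ∀ i j, (if (i, j) = c then μ.card else T i j) =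
          if (i, j) = c' then μ.card else T' i j := fun i j =>
        congrArg (fun U : {T : SemistandardYoungTableau μ // IsStandard T} => U.1 i j) h
      obtain rfl : c = c' := by
        by_contra hne
        have h1 := h' c.1 c.2
        rw [if_pos rfl, if_neg hne] at h1
        have h2 := (hT'.mapsTo (hc2.mem_removeCell.2 ⟨hc1.1, hne⟩)).2
        have h3 := hc2.card_removeCell
        simp only at h2
        omega
      congr
      ext i j
      by_cases hij : (i, j) = c
      · have hn : (i, j) ∉ removeCell μ c := fun hm => (hc1.mem_removeCell.1 hm).2 hij
        rw [T.zeros hn, T'.zeros hn]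
      · simpa [hij] using h' i j
    · rintro ⟨T, hT⟩
      obtain ⟨c, hc, hmax⟩ := hT.exists_isCorner h0
      refine ⟨⟨⟨c, mem_corners.2 hc⟩, restrict hc T, isStandard_restrict hc hT hmax⟩, ?_⟩
      apply Subtype.ext
      ext i j
      change (if (i, j) = c then μ.card else (if (i, j) = c then 0 else T i j)) = T i j
      split_ifs with h
      · rw [← hmax, ← h]
      · rfl
  have hfin : ∀ c : corners μ,
      Finite {T : SemistandardYoungTableau (removeCell μ c.1) // IsStandard T} :=
    fun c => finite_isStandard _
  rw [numSYT, ← Nat.card_congr (Equiv.ofBijective F hF), Nat.card_sigma,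
    ← Finset.sum_coe_sort (corners μ)]
  rfl

theorem numSYT_of_card_eq_zero {μ : YoungDiagram} (h0 : μ.card = 0) : numSYT μ = 1 := by
  have hmem : ∀ c, c ∉ μ := fun c hc => by
    rw [YoungDiagram.card, Finset.card_eq_zero] at h0
    rw [← YoungDiagram.mem_cells, h0] at hc
    simp at hc
  have hst : ∀ T : SemistandardYoungTableau μ, IsStandard T := fun T =>
    ⟨fun c hc => absurd hc (hmem c), fun c hc => absurd hc (hmem c), by
      rw [h0]; rintro v ⟨h1, h2⟩; omega⟩
  have : Unique {T : SemistandardYoungTableau μ // IsStandard T} :=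
    { default := ⟨SemistandardYoungTableau.highestWeight μ, hst _⟩
      uniq := fun T => by
        apply Subtype.ext
        ext i j
        rw [T.1.zeros (hmem _), SemistandardYoungTableau.zeros _ (hmem _)] }
  rw [numSYT, Nat.card_unique]

/-! ### Modified Bessel series -/

open PowerSeries

/-- The number of walks of length `n` on `ℤ` with steps `±1` from `0` to `k ≥ 0`. -/
def lineWalks : ℕ → ℕ → ℕ
  | 0, 0 => 1
  | 0, _ + 1 => 0
  | n + 1, 0 => 2 * lineWalks n 1
  | n + 1, k + 1 => lineWalks n k + lineWalks n (k + 2)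

theorem lineWalks_of_lt {n k : ℕ} (h : n < k) : lineWalks n k = 0 := by
  induction n generalizing k with
  | zero => obtain ⟨k, rfl⟩ := Nat.exists_eq_succ_of_ne_zero h.ne'; rfl
  | succ n ih =>
    obtain ⟨k, rfl⟩ := Nat.exists_eq_succ_of_ne_zero (Nat.ne_zero_of_lt h)
    rw [lineWalks, ih (by omega), ih (by omega)]

theorem lineWalks_of_odd {n k : ℕ} (h : (n + k) % 2 = 1) : lineWalks n k = 0 := by
  induction n generalizing k with
  | zero => exact lineWalks_of_lt (by omega)
  | succ n ih =>
    cases k with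
    | zero => rw [lineWalks, ih (by omega)]
    | succ k => rw [lineWalks, ih (by omega), ih (by omega)]

theorem lineWalks_eq_choose (j k : ℕ) : lineWalks (2 * j + k) k = (2 * j + k).choose j := by
  generalize hn : 2 * j + k = n
  induction n generalizing j k with
  | zero =>
    obtain rfl : j = 0 := by omega
    obtain rfl : k = 0 := by omega
    rfl
  | succ n ih =>
    cases k with
    | zero =>
      obtain ⟨j, rfl⟩ := Nat.exists_eq_succ_of_ne_zero (show j ≠ 0 by omega)
      obtain rfl : n = 2 * j + 1 := by omega
      rw [lineWalks, ih j 1 rfl, Nat.choose_succ_succ, Nat.choose_symm_half]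
      ring
    | succ k =>
      rw [lineWalks, ih j k (by omega)]
      cases j with
      | zero => rw [lineWalks_of_lt (by omega)]; simp
      | succ j => rw [ih j (k + 2) (by omega), Nat.choose_succ_succ, add_comm]

/-- The modified Bessel function `I_k(2x)`, as the exponential generating function of the walks
on `ℤ` from `0` to `k`. -/
noncomputable def bessel (k : ℕ) : ℚ⟦X⟧ := .mk fun n => lineWalks n k / n !

theorem derivative_bessel_zero : d⁄dX ℚ (bessel 0) = 2 * bessel 1 := by
  ext n
  rw [coeff_derivative, ← map_ofNat (C (R := ℚ)) 2, coeff_C_mul, bessel, bessel, coeff_mk, coeff_mk,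
    lineWalks, Nat.factorial_succ]
  push_cast
  field_simp

theorem derivative_bessel_succ (k : ℕ) :
    d⁄dX ℚ (bessel (k + 1)) = bessel k + bessel (k + 2) := by
  ext n
  rw [coeff_derivative, map_add, bessel, bessel, bessel, coeff_mk, coeff_mk, coeff_mk,
    lineWalks, Nat.factorial_succ]
  push_cast
  field_simp

theorem constantCoeff_bessel_zero : constantCoeff (bessel 0) = 1 := by
  rw [← coeff_zero_eq_constantCoeff_apply, bessel, coeff_mk]
  simp [lineWalks]

theorem constantCoeff_bessel_succ (k : ℕ) : constantCoeff (bessel (k + 1)) = 0 := by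
  rw [← coeff_zero_eq_constantCoeff_apply, bessel, coeff_mk]
  simp [lineWalks]

/-- `∑ xʲ / (j! (j + k)!)`, so that `I_k(2x) = xᵏ · reducedBessel k (x²)`. -/
noncomputable def reducedBessel (k : ℕ) : ℚ⟦X⟧ := .mk fun n => 1 / (n ! * (n + k)!)

theorem bessel_eq (k : ℕ) : bessel k = X ^ k * expand 2 two_ne_zero (reducedBessel k) := by
  ext n
  rw [coeff_X_pow_mul', bessel, coeff_mk]
  split_ifs with h
  · rw [coeff_expand]
    split_ifs with h2
    · obtain ⟨j, hj⟩ := h2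
      obtain rfl : n = 2 * j + k := by omega
      rw [lineWalks_eq_choose, Nat.cast_choose ℚ (by omega), reducedBessel, coeff_mk,
        show (2 * j + k - k) / 2 = j by omega, show 2 * j + k - j = j + k by omega]
      field_simp
    · rw [lineWalks_of_odd (by omega)]
      simp
  · rw [lineWalks_of_lt (by omega)]
    simp

/-- Vandermonde's identity gives the coefficients of a product of two reduced Bessel series. -/
theorem coeff_reducedBessel_mul (k l s : ℕ) :
    coeff s (reducedBessel k * reducedBessel l) =
      ((2 * s + k + l).choose s : ℚ) / ((s + k)! * (s + l)!) := by
  have hV := Nat.add_choose_eq (s + k) (s + l) s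
  rw [show s + k + (s + l) = 2 * s + k + l by ring] at hV
  rw [mul_comm (reducedBessel k), hV, coeff_mul, Nat.cast_sum, Finset.sum_div]
  refine Finset.sum_congr rfl fun ij hij => ?_
  obtain ⟨i, j⟩ := ij
  obtain rfl : i + j = s := by simpa using hij
  simp only [reducedBessel, coeff_mk]
  rw [Nat.cast_mul, Nat.cast_choose ℚ (show i ≤ i + j + k by omega),
    Nat.cast_choose ℚ (show j ≤ i + j + l by omega), show i + j + k - i = j + k by omega,
    show i + j + l - j = i + l by omega]
  field_simp

/-! ### Walks in the Weyl chamber of type `A₃` -/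

/-- `E_d = ∑ I_s` over `-d < s ≤ d`: the exponential generating function of the walks on `ℤ` that
start at `d`, each counted with the sign of its end point. -/
noncomputable def signSeries : ℕ → ℚ⟦X⟧
  | 0 => 0
  | d + 1 => signSeries d + bessel d + bessel (d + 1)

theorem derivative_signSeries (d : ℕ) :
    d⁄dX ℚ (signSeries (d + 1)) = signSeries (d + 2) + signSeries d := by
  induction d with
  | zero =>
    simp only [signSeries, map_add, zero_add, derivative_bessel_zero,
      derivative_bessel_succ]
    ring
  | succ d ih =>
    rw [signSeries, map_add, map_add, ih, derivative_bessel_succ, derivative_bessel_succ]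
    simp only [signSeries]
    ring

theorem constantCoeff_signSeries (d : ℕ) : constantCoeff (signSeries (d + 1)) = 1 := by
  induction d with
  | zero => simp [signSeries, constantCoeff_bessel_zero, constantCoeff_bessel_succ]
  | succ d ih => rw [signSeries, map_add, map_add, ih]; simp [constantCoeff_bessel_succ]

/-- The exponential generating function of the walks with steps `e₁, …, e₄` that start at a point
`x₁ > x₂ > x₃ > x₄` with gaps `a = x₁ - x₂`, `b = x₂ - x₃`, `c = x₃ - x₄` and keep this strict
order, with free end point. It is the Pfaffian of the matrix `(E_{x_i - x_j})`. -/
noncomputable def chamberSeries (a b c : ℕ) : ℚ⟦X⟧ :=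
  signSeries a * signSeries c - signSeries (a + b) * signSeries (b + c) +
    signSeries (a + b + c) * signSeries b

theorem chamberSeries_zero_left (b c : ℕ) : chamberSeries 0 b c = 0 := by
  simp only [chamberSeries, signSeries, zero_add]
  ring

theorem chamberSeries_zero_mid (a c : ℕ) : chamberSeries a 0 c = 0 := by
  simp only [chamberSeries, signSeries, zero_add, add_zero]
  ring

theorem chamberSeries_zero_right (a b : ℕ) : chamberSeries a b 0 = 0 := by
  simp only [chamberSeries, signSeries, add_zero]
  ring

theorem constantCoeff_chamberSeries (a b c : ℕ) :
    constantCoeff (chamberSeries (a + 1) (b + 1) (c + 1)) = 1 := by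
  have h : ∀ d, d ≠ 0 → constantCoeff (signSeries d) = 1 := fun d hd => by
    obtain ⟨d, rfl⟩ := Nat.exists_eq_succ_of_ne_zero hd
    exact constantCoeff_signSeries d
  simp only [chamberSeries, map_add, map_sub, map_mul]
  rw [h _ (by omega), h _ (by omega), h _ (by omega), h _ (by omega), h _ (by omega),
    h _ (by omega)]
  norm_num

/-- First-step decomposition: the first step increases one of the four coordinates. -/
theorem derivative_chamberSeries (a b c : ℕ) :
    d⁄dX ℚ (chamberSeries (a + 1) (b + 1) (c + 1)) =
      chamberSeries (a + 2) (b + 1) (c + 1) + chamberSeries a (b + 2) (c + 1) +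
        chamberSeries (a + 1) b (c + 2) + chamberSeries (a + 1) (b + 1) c := by
  have e1 : a + 1 + (b + 1) = a + b + 2 := by ring
  have e2 : b + 1 + (c + 1) = b + c + 2 := by ring
  have e3 : a + b + 2 + (c + 1) = a + b + c + 3 := by ring
  have e4 : a + 2 + (b + 1) = a + b + 3 := by ring
  have e5 : a + b + 3 + (c + 1) = a + b + c + 4 := by ring
  have e6 : a + (b + 2) = a + b + 2 := by ring
  have e7 : b + 2 + (c + 1) = b + c + 3 := by ring
  have e8 : a + 1 + b = a + b + 1 := by ring
  have e9 : b + (c + 2) = b + c + 2 := by ring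
  have e10 : a + b + 1 + (c + 2) = a + b + c + 3 := by ring
  have e11 : b + 1 + c = b + c + 1 := by ring
  have e12 : a + b + 2 + c = a + b + c + 2 := by ring
  have h1 : d⁄dX ℚ (signSeries (a + b + 2)) = _ := derivative_signSeries (a + b + 1)
  have h2 : d⁄dX ℚ (signSeries (b + c + 2)) = _ := derivative_signSeries (b + c + 1)
  have h3 : d⁄dX ℚ (signSeries (a + b + c + 3)) = _ := derivative_signSeries (a + b + c + 2)
  simp only [chamberSeries, map_add, map_sub, Derivation.leibniz, smul_eq_mul, e1, e2, e3, e4, e5,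
    e6, e7, e8, e9, e10, e11, e12, h1, h2, h3, derivative_signSeries]
  ring

/-! ### The number of walks from the apex of the chamber -/

theorem reducedBessel_sub (k : ℕ) :
    reducedBessel k - X * reducedBessel (k + 2) = ((k : ℚ⟦X⟧) + 1) * reducedBessel (k + 1) := by
  have hc : ((k : ℚ⟦X⟧) + 1) = C ((k : ℚ) + 1) := by simp
  ext n
  rw [hc, coeff_C_mul, map_sub]
  cases n with
  | zero =>
    rw [coeff_zero_X_mul]
    simp only [reducedBessel, coeff_mk, zero_add, Nat.factorial_succ]
    push_cast
    field_simp
    ring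
  | succ n =>
    rw [coeff_succ_X_mul]
    simp only [reducedBessel, coeff_mk]
    rw [show n + (k + 2) = n + k + 1 + 1 by ring, show n + 1 + k = n + k + 1 by ring,
      show n + 1 + (k + 1) = n + k + 1 + 1 by ring, Nat.factorial_succ n,
      Nat.factorial_succ (n + k + 1)]
    push_cast
    field_simp
    ring

/-- The chamber series of the apex in terms of `I₀` and `I₁ / x`, both written in `x²`. -/
theorem X_mul_chamberSeries_one :
    X * chamberSeries 1 1 1 =
      expand 2 two_ne_zero (2 * X * reducedBessel 1 ^ 2 - 2 * reducedBessel 0 ^ 2 +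
        2 * (reducedBessel 0 * reducedBessel 1)) +
      X * expand 2 two_ne_zero (reducedBessel 1 ^ 2) := by
  have r0 := congrArg (expand 2 two_ne_zero) (reducedBessel_sub 0)
  have r1 := congrArg (expand 2 two_ne_zero) (reducedBessel_sub 1)
  simp only [map_sub, map_mul, map_add, map_pow, map_one, expand_X, map_ofNat,
    zero_add, Nat.cast_zero, Nat.cast_one, Nat.reduceAdd, one_mul] at r0 r1 ⊢
  simp only [chamberSeries, signSeries, zero_add, Nat.reduceAdd, bessel_eq, pow_zero, pow_one,
    one_mul]
  set a := expand 2 two_ne_zero (reducedBessel 0)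
  set b := expand 2 two_ne_zero (reducedBessel 1)
  set c := expand 2 two_ne_zero (reducedBessel 2)
  set d := expand 2 two_ne_zero (reducedBessel 3)
  have hc : X ^ 2 * c = a - b := by linear_combination -r0
  have hd : X * (X ^ 3 * d) = X ^ 2 * b - 2 * (a - b) := by
    linear_combination (-X ^ 2) * r1 - 2 * hc
  rw [hc]
  linear_combination (a + X * b) * hd

theorem cast_catalan (t : ℕ) : (catalan t : ℚ) = (2 * t)! / (t ! * (t + 1)!) := by
  have h := congrArg (Nat.cast (R := ℚ)) (succ_mul_catalan_eq_centralBinom t)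
  rw [Nat.centralBinom, Nat.cast_choose ℚ (by omega), show 2 * t - t = t by omega] at h
  rw [Nat.factorial_succ]
  push_cast at h ⊢
  field_simp at h ⊢
  exact h

theorem factorial_mul_coeff_chamberSeries_even (t : ℕ) :
    ((2 * t)! : ℚ) * coeff (2 * t) (chamberSeries 1 1 1) = catalan t * catalan (t + 1) := by
  rw [← coeff_succ_X_mul, X_mul_chamberSeries_one, map_add, coeff_expand_of_not_dvd _ _ _ (by omega),
    coeff_succ_X_mul, coeff_expand_mul, sq, coeff_reducedBessel_mul, Nat.cast_choose ℚ (by omega),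
    cast_catalan, cast_catalan, show 2 * t + 1 + 1 - t = t + 1 + 1 by omega,
    show 2 * (t + 1) = 2 * t + 1 + 1 by ring]
  field_simp
  ring

theorem factorial_mul_coeff_chamberSeries_odd (t : ℕ) :
    ((2 * t + 1)! : ℚ) * coeff (2 * t + 1) (chamberSeries 1 1 1) = catalan (t + 1) ^ 2 := by
  have h2 : (2 : ℚ⟦X⟧) = C 2 := (map_ofNat C 2).symm
  rw [← coeff_succ_X_mul, X_mul_chamberSeries_one, map_add, coeff_succ_X_mul,
    coeff_expand_of_not_dvd (m := 2 * t + 1) _ _ _ (by omega),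
    show 2 * t + 1 + 1 = 2 * (t + 1) by ring, coeff_expand_mul, map_add, map_sub, mul_assoc, h2,
    coeff_C_mul, coeff_C_mul, coeff_C_mul, coeff_succ_X_mul, sq, sq, coeff_reducedBessel_mul,
    coeff_reducedBessel_mul, coeff_reducedBessel_mul, Nat.cast_choose ℚ (by omega),
    Nat.cast_choose ℚ (by omega), Nat.cast_choose ℚ (by omega), cast_catalan,
    show 2 * t + 1 + 1 - t = t + 1 + 1 by omega,
    show 2 * (t + 1) + 0 + 0 - (t + 1) = t + 1 by omega,
    show 2 * (t + 1) + 0 + 1 - (t + 1) = t + 1 + 1 by omega,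
    show 2 * (t + 1) + 0 + 1 = 2 * t + 1 + 1 + 1 by ring,
    show 2 * (t + 1) + 0 + 0 = 2 * t + 1 + 1 by ring,
    show 2 * (t + 1) = 2 * t + 1 + 1 by ring]
  simp only [Nat.factorial_succ, add_zero]
  push_cast
  field_simp
  ring

/-! ### Growing diagrams with at most four rows -/

theorem rowLen_eq_of_mem_iff {μ : YoungDiagram} {i n : ℕ} (h : ∀ j, (i, j) ∈ μ ↔ j < n) :
    μ.rowLen i = n := by
  refine le_antisymm ?_ ?_
  · by_contra! hlt
    exact lt_irrefl _ ((h n).1 (YoungDiagram.mem_iff_lt_rowLen.2 hlt))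
  · by_contra! hlt
    exact lt_irrefl _ (YoungDiagram.mem_iff_lt_rowLen.1 ((h _).2 hlt))

theorem IsCorner.rowLen_eq {μ : YoungDiagram} {c : ℕ × ℕ} (hc : IsCorner μ c) :
    μ.rowLen c.1 = c.2 + 1 := by
  have h1 := YoungDiagram.mem_iff_lt_rowLen.1 hc.1
  have h2 := YoungDiagram.mem_iff_lt_rowLen.not.1 hc.2.2
  omega

/-- Row `i` of `μ` can be extended by one cell. -/
def Addable (μ : YoungDiagram) (i : ℕ) : Prop :=
  i = 0 ∨ μ.rowLen i < μ.rowLen (i - 1)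

/-- The join of `μ` with the rectangle spanned by the cell `(i, μ.rowLen i)`. This is a Young
diagram for every `i`; for an addable row `i` it is `μ` with row `i` extended by one cell. -/
def addCell (μ : YoungDiagram) (i : ℕ) : YoungDiagram where
  cells := μ.cells ∪ Finset.range (i + 1) ×ˢ Finset.range (μ.rowLen i + 1)
  isLowerSet := by
    intro c d hdc hc
    obtain ⟨h1, h2⟩ := Prod.mk_le_mk.1 hdc
    simp only [Finset.coe_union, Set.mem_union, Finset.mem_coe, YoungDiagram.mem_cells,
      Finset.mem_product, Finset.mem_range] at hc ⊢
    rcases hc with hc | hc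
    · exact Or.inl (μ.isLowerSet hdc hc)
    · exact Or.inr ⟨by omega, by omega⟩

theorem Addable.mem_addCell {μ : YoungDiagram} {i : ℕ} (h : Addable μ i) {d : ℕ × ℕ} :
    d ∈ addCell μ i ↔ d ∈ μ ∨ d = (i, μ.rowLen i) := by
  obtain ⟨a, b⟩ := d
  rw [← YoungDiagram.mem_cells, addCell, Finset.mem_union, YoungDiagram.mem_cells,
    Finset.mem_product, Finset.mem_range, Finset.mem_range, Prod.mk_inj,
    YoungDiagram.mem_iff_lt_rowLen]
  simp only
  have hanti := μ.rowLen_anti a (i - 1)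
  constructor
  · rintro (h1 | ⟨h1, h2⟩)
    · exact Or.inl h1
    · rcases eq_or_ne a i with rfl | hne
      · omega
      · rcases h with rfl | h
        · omega
        · have := hanti (by omega)
          omega
  · rintro (h1 | ⟨h1, h2⟩)
    · exact Or.inl h1
    · exact Or.inr ⟨by omega, by omega⟩

theorem Addable.rowLen_addCell {μ : YoungDiagram} {i : ℕ} (h : Addable μ i) (k : ℕ) :
    (addCell μ i).rowLen k = if k = i then μ.rowLen k + 1 else μ.rowLen k := by
  refine rowLen_eq_of_mem_iff fun j => ?_
  rw [h.mem_addCell, YoungDiagram.mem_iff_lt_rowLen, Prod.mk_inj]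
  split_ifs with hk
  · subst hk
    omega
  · omega

theorem Addable.isCorner {μ : YoungDiagram} {i : ℕ} (h : Addable μ i) :
    IsCorner (addCell μ i) (i, μ.rowLen i) := by
  refine ⟨h.mem_addCell.2 (Or.inr rfl), fun hm => ?_, fun hm => ?_⟩
  · have := YoungDiagram.mem_iff_lt_rowLen.1 hm
    simp only [h.rowLen_addCell] at this
    have := μ.rowLen_anti i (i + 1) (by omega)
    rw [if_neg (by omega)] at *
    omega
  · have := YoungDiagram.mem_iff_lt_rowLen.1 hm
    simp only [h.rowLen_addCell, if_pos] at this
    omega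

theorem Addable.removeCell_addCell {μ : YoungDiagram} {i : ℕ} (h : Addable μ i) :
    removeCell (addCell μ i) (i, μ.rowLen i) = μ := by
  ext d
  rw [YoungDiagram.mem_cells, YoungDiagram.mem_cells, h.isCorner.mem_removeCell, h.mem_addCell]
  refine ⟨fun hd => hd.1.resolve_right hd.2, fun hd => ⟨Or.inl hd, ?_⟩⟩
  rintro rfl
  exact lt_irrefl _ (YoungDiagram.mem_iff_lt_rowLen.1 hd)

theorem IsCorner.rowLen_removeCell {μ : YoungDiagram} {c : ℕ × ℕ} (hc : IsCorner μ c) (k : ℕ) :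
    (removeCell μ c).rowLen k = if k = c.1 then c.2 else μ.rowLen k := by
  have hr := hc.rowLen_eq
  obtain ⟨a, b⟩ := c
  refine rowLen_eq_of_mem_iff fun j => ?_
  rw [hc.mem_removeCell, YoungDiagram.mem_iff_lt_rowLen, Ne, Prod.mk_inj]
  simp only at hr ⊢
  split_ifs with hk
  · subst hk
    omega
  · omega

theorem IsCorner.addable_removeCell {μ : YoungDiagram} {c : ℕ × ℕ} (hc : IsCorner μ c) :
    Addable (removeCell μ c) c.1 := by
  rw [Addable, hc.rowLen_removeCell, hc.rowLen_removeCell, if_pos rfl]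
  rcases Nat.eq_zero_or_pos c.1 with h | h
  · exact Or.inl h
  · right
    rw [if_neg (by omega)]
    have := μ.rowLen_anti (c.1 - 1) c.1 (by omega)
    have := hc.rowLen_eq
    omega

theorem IsCorner.addCell_removeCell {μ : YoungDiagram} {c : ℕ × ℕ} (hc : IsCorner μ c) :
    addCell (removeCell μ c) c.1 = μ := by
  ext d
  rw [YoungDiagram.mem_cells, YoungDiagram.mem_cells, hc.addable_removeCell.mem_addCell,
    hc.mem_removeCell, hc.rowLen_removeCell, if_pos rfl]
  refine ⟨?_, fun hd => ?_⟩
  · rintro (hd | rfl)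
    · exact hd.1
    · exact hc.1
  · by_cases h : d = c
    · exact Or.inr h
    · exact Or.inl ⟨hd, h⟩

theorem Addable.card_addCell {μ : YoungDiagram} {i : ℕ} (h : Addable μ i) :
    (addCell μ i).card = μ.card + 1 := by
  rw [← h.isCorner.card_removeCell, h.removeCell_addCell]

/-- The chamber series of the point `(μ₁ + 3, μ₂ + 2, μ₃ + 1, μ₄)`. -/
noncomputable def diagramSeries (μ : YoungDiagram) : ℚ⟦X⟧ :=
  chamberSeries (μ.rowLen 0 - μ.rowLen 1 + 1) (μ.rowLen 1 - μ.rowLen 2 + 1)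
    (μ.rowLen 2 - μ.rowLen 3 + 1)

open scoped Classical in
theorem derivative_diagramSeries (μ : YoungDiagram) :
    d⁄dX ℚ (diagramSeries μ) =
      ∑ i ∈ (Finset.range 4).filter (Addable μ), diagramSeries (addCell μ i) := by
  have h01 := μ.rowLen_anti 0 1 (by omega)
  have h12 := μ.rowLen_anti 1 2 (by omega)
  have h23 := μ.rowLen_anti 2 3 (by omega)
  rw [diagramSeries, derivative_chamberSeries, Finset.sum_filter]
  simp only [Finset.sum_range_succ, Finset.range_zero, Finset.sum_empty, zero_add]
  congr 1
  · congr 1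
    · congr 1
      · have h : Addable μ 0 := Or.inl rfl
        rw [if_pos h]
        simp only [diagramSeries, h.rowLen_addCell]
        congr 1
        simp only [if_true, one_ne_zero, if_false]
        omega
      · split_ifs with h
        · have h' : μ.rowLen 1 < μ.rowLen 0 := h.resolve_left one_ne_zero
          simp only [diagramSeries, h.rowLen_addCell]
          norm_num
          congr 1 <;> omega
        · have h' : ¬ μ.rowLen 1 < μ.rowLen 0 := fun h' => h (Or.inr h')
          rw [show μ.rowLen 0 - μ.rowLen 1 = 0 by omega, chamberSeries_zero_left]
    · split_ifs with h
      · have h' : μ.rowLen 2 < μ.rowLen 1 := h.resolve_left two_ne_zero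
        simp only [diagramSeries, h.rowLen_addCell]
        norm_num
        congr 1 <;> omega
      · have h' : ¬ μ.rowLen 2 < μ.rowLen 1 := fun h' => h (Or.inr h')
        rw [show μ.rowLen 1 - μ.rowLen 2 = 0 by omega, chamberSeries_zero_mid]
  · split_ifs with h
    · have h' : μ.rowLen 3 < μ.rowLen 2 := h.resolve_left three_ne_zero
      simp only [diagramSeries, h.rowLen_addCell]
      norm_num
      congr 1
      omega
    · have h' : ¬ μ.rowLen 3 < μ.rowLen 2 := fun h' => h (Or.inr h')
      rw [show μ.rowLen 2 - μ.rowLen 3 = 0 by omega, chamberSeries_zero_right]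

/-- The number of ways to extend `μ` by `r` cells, one at a time, through diagrams with at most
four rows, for `μ` itself with at most four rows. -/
noncomputable def extensions (r : ℕ) (μ : YoungDiagram) : ℚ :=
  r ! * coeff r (diagramSeries μ)

theorem extensions_zero (μ : YoungDiagram) : extensions 0 μ = 1 := by
  rw [extensions, coeff_zero_eq_constantCoeff_apply, diagramSeries, constantCoeff_chamberSeries]
  simp

open scoped Classical in
theorem extensions_succ (r : ℕ) (μ : YoungDiagram) :
    extensions (r + 1) μ =
      ∑ i ∈ (Finset.range 4).filter (Addable μ), extensions r (addCell μ i) := by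
  simp only [extensions]
  rw [← Finset.mul_sum, ← map_sum, ← derivative_diagramSeries, coeff_derivative,
    Nat.factorial_succ]
  push_cast
  ring

theorem mem_hook {k l n : ℕ} {μ : YoungDiagram} :
    μ ∈ (hook_finite k l n).toFinset ↔ μ.card = n ∧ μ.rowLen k ≤ l := by
  rw [Set.Finite.mem_toFinset]
  rfl

/-- Double counting of the pairs of a diagram and a corner of it: the number of ways to grow a
diagram with `n + r` cells and at most four rows does not depend on the moment at which the growth
is cut into a standard tableau and an extension. -/
theorem sum_numSYT_mul_extensions_succ (n r : ℕ) :
    ∑ μ ∈ (hook_finite 4 0 n).toFinset, (numSYT μ : ℚ) * extensions (r + 1) μ =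
      ∑ μ ∈ (hook_finite 4 0 (n + 1)).toFinset, (numSYT μ : ℚ) * extensions r μ := by
  classical
  have hR : ∀ μ ∈ (hook_finite 4 0 (n + 1)).toFinset, (numSYT μ : ℚ) * extensions r μ =
      ∑ c ∈ corners μ, (numSYT (removeCell μ c) : ℚ) * extensions r μ := fun μ hμ => by
    have := (mem_hook.1 hμ).1
    rw [numSYT_eq_sum_corners (by omega), Nat.cast_sum, Finset.sum_mul]
  rw [Finset.sum_congr rfl hR]
  simp only [extensions_succ, Finset.mul_sum]
  rw [Finset.sum_sigma', Finset.sum_sigma']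
  refine Finset.sum_bij' (fun x _ => ⟨addCell x.1 x.2, (x.2, x.1.rowLen x.2)⟩)
    (fun y _ => ⟨removeCell y.1 y.2, y.2.1⟩) ?_ ?_ ?_ ?_ ?_
  · rintro ⟨μ, i⟩ h
    simp only [Finset.mem_sigma, mem_hook, Finset.mem_filter, Finset.mem_range, mem_corners] at h ⊢
    obtain ⟨⟨h1, h2⟩, h3, h4⟩ := h
    refine ⟨⟨by rw [h4.card_addCell, h1], ?_⟩, h4.isCorner⟩
    rw [h4.rowLen_addCell, if_neg (by omega)]
    exact h2
  · rintro ⟨μ, c⟩ h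
    simp only [Finset.mem_sigma, mem_hook, Finset.mem_filter, Finset.mem_range, mem_corners] at h ⊢
    obtain ⟨⟨h1, h2⟩, hc⟩ := h
    have h3 : c.1 < 4 := by
      by_contra! h3
      have := μ.rowLen_anti 4 c.1 h3
      have := hc.rowLen_eq
      omega
    refine ⟨⟨?_, ?_⟩, h3, hc.addable_removeCell⟩
    · have := hc.card_removeCell
      omega
    · rw [hc.rowLen_removeCell, if_neg (by omega)]
      exact h2
  · rintro ⟨μ, i⟩ h
    simp only [Finset.mem_sigma, Finset.mem_filter] at h
    simp only [h.2.2.removeCell_addCell]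
  · rintro ⟨μ, c⟩ h
    simp only [Finset.mem_sigma, mem_corners] at h
    simp only [h.2.addCell_removeCell, h.2.rowLen_removeCell, if_true]
  · rintro ⟨μ, i⟩ h
    simp only [Finset.mem_sigma, Finset.mem_filter] at h
    simp only [h.2.2.removeCell_addCell]

theorem S_four_zero (n : ℕ) : (S 4 0 n : ℚ) = n ! * coeff n (chamberSeries 1 1 1) := by
  have hshift : ∀ r n, ∑ μ ∈ (hook_finite 4 0 n).toFinset, (numSYT μ : ℚ) * extensions r μ =
      S 4 0 (n + r) := by
    intro r
    induction r with
    | zero =>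
      intro n
      simp [S, extensions_zero]
    | succ r ih =>
      intro n
      rw [sum_numSYT_mul_extensions_succ, ih, show n + 1 + r = n + (r + 1) by ring]
  have hbot : (hook_finite 4 0 0).toFinset = {⊥} := by
    ext μ
    rw [mem_hook, Finset.mem_singleton]
    constructor
    · rintro ⟨h, -⟩
      exact YoungDiagram.ext (Finset.card_eq_zero.1 h)
    · rintro rfl
      exact ⟨rfl, (rowLen_eq_of_mem_iff (n := 0) fun j => by simp).le⟩
  have hrow : ∀ i, (⊥ : YoungDiagram).rowLen i = 0 := fun i =>
    rowLen_eq_of_mem_iff fun j => by simp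
  rw [← zero_add n, ← hshift, hbot, Finset.sum_singleton, numSYT_of_card_eq_zero rfl, extensions,
    diagramSeries]
  simp only [hrow, zero_add, Nat.cast_one, one_mul, Nat.sub_self]

theorem S_four_zero_even (t : ℕ) : S 4 0 (2 * t) = catalan t * catalan (t + 1) := by
  have h := S_four_zero (2 * t)
  rw [factorial_mul_coeff_chamberSeries_even] at h
  exact_mod_cast h

theorem S_four_zero_odd (t : ℕ) : S 4 0 (2 * t + 1) = catalan (t + 1) ^ 2 := by
  have h := S_four_zero (2 * t + 1)
  rw [factorial_mul_coeff_chamberSeries_odd] at h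
  exact_mod_cast h

/-! ### Hooks and double hooks -/

theorem isCorner_iff {μ : YoungDiagram} {i j : ℕ} :
    IsCorner μ (i, j) ↔ μ.rowLen i = j + 1 ∧ μ.rowLen (i + 1) ≤ j := by
  simp only [IsCorner, YoungDiagram.mem_iff_lt_rowLen]
  omega

theorem mem_ite_singleton {α : Type*} {P : Prop} [Decidable P] {x c : α} :
    x ∈ (if P then {c} else ∅ : Finset α) ↔ P ∧ x = c := by
  split_ifs with h <;> simp [h]

theorem sum_ite_singleton {α : Type*} {P : Prop} [Decidable P] {c : α} (f : α → ℕ) :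
    ∑ x ∈ (if P then {c} else ∅ : Finset α), f x = if P then f c else 0 := by
  split_ifs with h <;> simp

theorem card_ne_zero_of_rowLen_pos {μ : YoungDiagram} {i : ℕ} (h : 0 < μ.rowLen i) :
    μ.card ≠ 0 :=
  Finset.card_ne_zero_of_mem ((YoungDiagram.mem_cells _).2 (YoungDiagram.mem_iff_lt_rowLen.2 h))

/-- The length of row `i` of the hook `(a + 1, 1^l)`. -/
def hookRow (a l i : ℕ) : ℕ :=
  if i = 0 then a + 1 else if i < l + 1 then 1 else 0

theorem numSYT_of_hookRow {μ : YoungDiagram} {a l : ℕ} (h : ∀ i, μ.rowLen i = hookRow a l i) :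
    numSYT μ = (a + l).choose l := by
  generalize hn : a + l = n
  induction n generalizing μ a l with
  | zero =>
    obtain ⟨rfl, rfl⟩ : a = 0 ∧ l = 0 := by omega
    have hc : corners μ = {(0, 0)} := by
      ext ⟨i, j⟩
      have e1 := h i
      have e2 := h (i + 1)
      rw [mem_corners, isCorner_iff, Finset.mem_singleton, Prod.mk_inj]
      unfold hookRow at e1 e2
      split_ifs at e1 e2 <;> first | omega | contradiction
    have h0 : IsCorner μ (0, 0) := mem_corners.1 (hc ▸ Finset.mem_singleton_self _)
    rw [numSYT_eq_sum_corners (card_ne_zero_of_rowLen_pos (i := 0) (by simp [h, hookRow])), hc,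
      Finset.sum_singleton, numSYT_of_card_eq_zero]
    · rfl
    · rw [YoungDiagram.card, Finset.card_eq_zero, Finset.eq_empty_iff_forall_notMem]
      rintro ⟨i, j⟩ hm
      rw [YoungDiagram.mem_cells, YoungDiagram.mem_iff_lt_rowLen, h0.rowLen_removeCell, h,
        hookRow] at hm
      simp only at hm
      split_ifs at hm <;> omega
  | succ n ih =>
    have hc : corners μ = (if 0 < a then {(0, a)} else ∅) ∪ (if 0 < l then {(l, 0)} else ∅) := by
      ext ⟨i, j⟩
      have e1 := h i
      have e2 := h (i + 1)
      rw [mem_corners, isCorner_iff, Finset.mem_union, mem_ite_singleton, mem_ite_singleton,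
        Prod.mk_inj, Prod.mk_inj]
      unfold hookRow at e1 e2
      split_ifs at e1 e2 <;> first | omega | contradiction
    have hd : Disjoint (if 0 < a then {(0, a)} else ∅ : Finset (ℕ × ℕ))
        (if 0 < l then {(l, 0)} else ∅) := by
      rw [Finset.disjoint_left]
      rintro ⟨i, j⟩ h1 h2
      rw [mem_ite_singleton, Prod.mk_inj] at h1 h2
      omega
    have hA : (if 0 < a then numSYT (removeCell μ (0, a)) else 0) =
        if 0 < a then n.choose l else 0 := by
      refine if_ctx_congr Iff.rfl (fun ha => ?_) fun _ => rfl
      have hcor : IsCorner μ (0, a) := mem_corners.1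
        (hc ▸ Finset.mem_union_left _ (mem_ite_singleton.2 ⟨ha, rfl⟩))
      refine ih (a := a - 1) (l := l) (fun i => ?_) (by omega)
      rw [hcor.rowLen_removeCell, h, hookRow, hookRow]
      split_ifs <;> omega
    have hL : (if 0 < l then numSYT (removeCell μ (l, 0)) else 0) =
        if 0 < l then n.choose (l - 1) else 0 := by
      refine if_ctx_congr Iff.rfl (fun hl => ?_) fun _ => rfl
      have hcor : IsCorner μ (l, 0) := mem_corners.1
        (hc ▸ Finset.mem_union_right _ (mem_ite_singleton.2 ⟨hl, rfl⟩))
      refine ih (a := a) (l := l - 1) (fun i => ?_) (by omega)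
      rw [hcor.rowLen_removeCell, h, hookRow, hookRow]
      split_ifs <;> omega
    rw [numSYT_eq_sum_corners (card_ne_zero_of_rowLen_pos (i := 0) (by simp [h, hookRow])), hc,
      Finset.sum_union hd, sum_ite_singleton, sum_ite_singleton, hA, hL]
    rcases Nat.eq_zero_or_pos l with rfl | hl
    · rw [if_pos (by omega)]
      simp
    · obtain ⟨l, rfl⟩ := Nat.exists_eq_succ_of_ne_zero hl.ne'
      rw [if_pos hl, Nat.choose_succ_succ, Nat.succ_sub_one, add_comm]
      congr 1
      split_ifs with ha
      · rfl
      · exact (Nat.choose_eq_zero_of_lt (by omega)).symm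

/-- The length of row `i` of the double hook `(a + 2, b + 2, 2^p, 1^q)`. -/
def doubleHookRow (a b p q i : ℕ) : ℕ :=
  if i = 0 then a + 2 else if i = 1 then b + 2 else if i < p + 2 then 2
  else if i < p + q + 2 then 1 else 0

/-- The value of the hook length formula at `(a + 2, b + 2, 2^p, 1^q)`, for `b ≤ a`. -/
def doubleHookCount (a b p q : ℕ) : ℚ :=
  (a + b + 2 * p + q + 4)! * (a - b + 1) * (q + 1) /
    ((a + 1)! * b ! * (p + q + 1)! * p ! * (b + p + 1) * (a + p + 2) * (b + p + q + 2) *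
      (a + p + q + 3))

theorem doubleHookCount_row_zero {a b : ℕ} (p q : ℕ) (hab : b ≤ a) :
    (if b < a then doubleHookCount (a - 1) b p q else 0) =
      doubleHookCount a b p q / (a + b + 2 * p + q + 4) *
        ((a - b) / (a - b + 1) * (a + 1) * (a + p + 2) / (a + p + 1) *
          (a + p + q + 3) / (a + p + q + 2)) := by
  obtain ⟨d, rfl⟩ := Nat.exists_eq_add_of_le hab
  cases d with
  | zero => simp
  | succ d =>
    rw [if_pos (by omega), doubleHookCount, doubleHookCount,
      show b + (d + 1) - 1 = b + d by omega,
      show b + (d + 1) + b + 2 * p + q + 4 = (b + d + b + 2 * p + q + 4) + 1 by ring,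
      Nat.factorial_succ (b + d + b + 2 * p + q + 4), Nat.factorial_succ (b + (d + 1)),
      show b + (d + 1) = b + d + 1 by ring]
    push_cast
    have : (b : ℚ) + d - b + 1 ≠ 0 := by
      rw [add_sub_cancel_left]
      positivity
    have : (b : ℚ) + d + 1 - b + 1 ≠ 0 := by
      rw [add_assoc, add_sub_cancel_left]
      positivity
    field_simp
    ring

theorem doubleHookCount_row_one {a b : ℕ} (p q : ℕ) (hab : b ≤ a) :
    (if 0 < b then doubleHookCount a (b - 1) p q else 0) =
      doubleHookCount a b p q / (a + b + 2 * p + q + 4) *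
        ((a - b + 2) / (a - b + 1) * b * (b + p + 1) / (b + p) *
          (b + p + q + 2) / (b + p + q + 1)) := by
  obtain ⟨d, rfl⟩ := Nat.exists_eq_add_of_le hab
  cases b with
  | zero => simp
  | succ b =>
    rw [if_pos (by omega), doubleHookCount, doubleHookCount, Nat.succ_sub_one,
      show b + 1 + d + (b + 1) + 2 * p + q + 4 = (b + 1 + d + b + 2 * p + q + 4) + 1 by ring,
      Nat.factorial_succ (b + 1 + d + b + 2 * p + q + 4), Nat.factorial_succ b]
    push_cast
    have : (b : ℚ) + 1 + d - (b + 1) + 1 ≠ 0 := by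
      rw [add_sub_cancel_left]
      positivity
    field_simp
    ring

theorem doubleHookCount_column_one (a b p q : ℕ) :
    (if 0 < p then doubleHookCount a b (p - 1) (q + 1) else 0) =
      doubleHookCount a b p q / (a + b + 2 * p + q + 4) *
        ((q + 2) / (q + 1) * p * (b + p + 1) / (b + p) * (a + p + 2) / (a + p + 1)) := by
  cases p with
  | zero => simp
  | succ p =>
    rw [if_pos (by omega), doubleHookCount, doubleHookCount, Nat.succ_sub_one,
      show a + b + 2 * (p + 1) + q + 4 = (a + b + 2 * p + (q + 1) + 4) + 1 by ring,
      Nat.factorial_succ (a + b + 2 * p + (q + 1) + 4), Nat.factorial_succ p,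
      show p + (q + 1) = p + 1 + q by ring]
    push_cast
    field_simp
    ring

theorem doubleHookCount_column_zero (a b p q : ℕ) :
    (if 0 < q then doubleHookCount a b p (q - 1) else 0) =
      doubleHookCount a b p q / (a + b + 2 * p + q + 4) *
        (q / (q + 1) * (p + q + 1) * (b + p + q + 2) / (b + p + q + 1) *
          (a + p + q + 3) / (a + p + q + 2)) := by
  cases q with
  | zero => simp
  | succ q =>
    rw [if_pos (by omega), doubleHookCount, doubleHookCount, Nat.succ_sub_one,
      show a + b + 2 * p + (q + 1) + 4 = (a + b + 2 * p + q + 4) + 1 by ring,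
      Nat.factorial_succ (a + b + 2 * p + q + 4), show p + (q + 1) + 1 = p + q + 1 + 1 by ring,
      Nat.factorial_succ (p + q + 1)]
    push_cast
    field_simp
    ring

/-- The branching rule for `doubleHookCount`. The last summand stands for the hook that is left when
the cell `(1, 1)` is a corner. -/
theorem doubleHookCount_eq_sum {a b : ℕ} (p q : ℕ) (hab : b ≤ a) :
    doubleHookCount a b p q =
      (if b < a then doubleHookCount (a - 1) b p q else 0) +
      (if 0 < b then doubleHookCount a (b - 1) p q else 0) +
      (if 0 < p then doubleHookCount a b (p - 1) (q + 1) else 0) +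
      (if 0 < q then doubleHookCount a b p (q - 1) else 0) +
      (if b = 0 ∧ p = 0 then ((a + q + 2).choose (q + 1) : ℚ) else 0) := by
  rw [doubleHookCount_row_zero p q hab, doubleHookCount_row_one p q hab,
    doubleHookCount_column_one, doubleHookCount_column_zero]
  have hn : (a : ℚ) + b + 2 * p + q + 4 ≠ 0 := by positivity
  have hd : (a : ℚ) - b + 1 ≠ 0 := by
    have : (b : ℚ) ≤ a := by exact_mod_cast hab
    linarith
  split_ifs with h
  · obtain ⟨rfl, rfl⟩ := h
    rw [doubleHookCount, Nat.cast_choose ℚ (by omega), show a + q + 2 - (q + 1) = a + 1 by omega,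
      show a + 0 + 2 * 0 + q + 4 = a + q + 2 + 1 + 1 by ring, Nat.factorial_succ,
      Nat.factorial_succ]
    simp only [zero_add, Nat.factorial_zero]
    push_cast
    simp only [sub_zero, mul_zero, add_zero, zero_add, zero_mul, zero_div, mul_one] at hd ⊢
    field_simp
    ring
  · have hbp : (b : ℚ) + p ≠ 0 := by
      have : 0 < b + p := by omega
      exact_mod_cast this.ne'
    rw [← mul_add, ← mul_add, ← mul_add, add_zero]
    rw [div_mul_eq_mul_div, eq_div_iff hn]
    congr 1
    field_simp
    ring

theorem numSYT_of_doubleHookRow {μ : YoungDiagram} {a b p q : ℕ} (hab : b ≤ a)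
    (h : ∀ i, μ.rowLen i = doubleHookRow a b p q i) :
    (numSYT μ : ℚ) = doubleHookCount a b p q := by
  generalize hn : a + b + 2 * p + q = n
  induction n using Nat.strong_induction_on generalizing μ a b p q with
  | _ n ih =>
  have hc : corners μ = (if b < a then {(0, a + 1)} else ∅) ∪
      (if 0 < b ∨ p = 0 then {(1, b + 1)} else ∅) ∪ (if 0 < p then {(p + 1, 1)} else ∅) ∪
      (if 0 < q then {(p + q + 1, 0)} else ∅) := by
    ext ⟨i, j⟩
    have e1 := h i
    have e2 := h (i + 1)
    simp only [mem_corners, isCorner_iff, Finset.mem_union, mem_ite_singleton, Prod.mk_inj]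
    unfold doubleHookRow at e1 e2
    split_ifs at e1 e2 <;> first | omega | contradiction
  have hd : ∀ {P Q : Prop} [Decidable P] [Decidable Q] {c d : ℕ × ℕ}, ¬ (P ∧ Q ∧ c = d) →
      Disjoint (if P then {c} else ∅ : Finset (ℕ × ℕ)) (if Q then {d} else ∅) := by
    intro P Q _ _ c d hne
    rw [Finset.disjoint_left]
    intro x h1 h2
    rw [mem_ite_singleton] at h1 h2
    exact hne ⟨h1.1, h2.1, h1.2.symm.trans h2.2⟩
  have hcor : ∀ {i j : ℕ}, (i, j) ∈ corners μ → ∀ k, (removeCell μ (i, j)).rowLen k =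
      if k = i then j else doubleHookRow a b p q k := fun hij k => by
    rw [(mem_corners.1 hij).rowLen_removeCell, h]
  rw [hc] at hcor
  simp only [Finset.mem_union, mem_ite_singleton] at hcor
  have h0 : (if b < a then (numSYT (removeCell μ (0, a + 1)) : ℚ) else 0) =
      if b < a then doubleHookCount (a - 1) b p q else 0 := by
    refine if_ctx_congr Iff.rfl (fun hP => ?_) fun _ => rfl
    refine ih (n - 1) (by omega) (by omega) (fun i => ?_) (by omega)
    rw [hcor (Or.inl (Or.inl (Or.inl ⟨hP, rfl⟩))), doubleHookRow, doubleHookRow]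
    split_ifs <;> omega
  have h1 : (if 0 < b ∨ p = 0 then (numSYT (removeCell μ (1, b + 1)) : ℚ) else 0) =
      (if 0 < b then doubleHookCount a (b - 1) p q else 0) +
      (if b = 0 ∧ p = 0 then ((a + q + 2).choose (q + 1) : ℚ) else 0) := by
    split_ifs with hP hb hb' hb' hb hb' hb'
    · omega
    · rw [add_zero]
      refine ih (n - 1) (by omega) (by omega) (fun i => ?_) (by omega)
      rw [hcor (Or.inl (Or.inl (Or.inr ⟨hP, rfl⟩))), doubleHookRow, doubleHookRow]
      split_ifs <;> omega
    · obtain ⟨rfl, rfl⟩ := hb'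
      suffices hrow : ∀ i, (removeCell μ (1, 0 + 1)).rowLen i = hookRow (a + 1) (q + 1) i by
        rw [numSYT_of_hookRow hrow, show a + 1 + (q + 1) = a + q + 2 by ring, zero_add]
      intro i
      rw [hcor (Or.inl (Or.inl (Or.inr ⟨hP, rfl⟩))), doubleHookRow, hookRow]
      split_ifs <;> omega
    all_goals first | omega | simp
  have h2 : (if 0 < p then (numSYT (removeCell μ (p + 1, 1)) : ℚ) else 0) =
      if 0 < p then doubleHookCount a b (p - 1) (q + 1) else 0 := by
    refine if_ctx_congr Iff.rfl (fun hP => ?_) fun _ => rfl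
    refine ih (n - 1) (by omega) hab (fun i => ?_) (by omega)
    rw [hcor (Or.inl (Or.inr ⟨hP, rfl⟩)), doubleHookRow, doubleHookRow]
    split_ifs <;> omega
  have h3 : (if 0 < q then (numSYT (removeCell μ (p + q + 1, 0)) : ℚ) else 0) =
      if 0 < q then doubleHookCount a b p (q - 1) else 0 := by
    refine if_ctx_congr Iff.rfl (fun hP => ?_) fun _ => rfl
    refine ih (n - 1) (by omega) hab (fun i => ?_) (by omega)
    rw [hcor (Or.inr ⟨hP, rfl⟩), doubleHookRow, doubleHookRow]
    split_ifs <;> omega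
  rw [numSYT_eq_sum_corners (card_ne_zero_of_rowLen_pos (i := 0) (by simp [h, doubleHookRow])), hc,
    Finset.sum_union, Finset.sum_union, Finset.sum_union, sum_ite_singleton, sum_ite_singleton,
    sum_ite_singleton, sum_ite_singleton]
  · push_cast
    rw [h0, h1, h2, h3, doubleHookCount_eq_sum p q hab]
    ring
  · exact hd (by rw [Prod.mk_inj]; omega)
  · rw [Finset.disjoint_union_left]
    exact ⟨hd (by rw [Prod.mk_inj]; omega), hd (by rw [Prod.mk_inj]; omega)⟩
  · rw [Finset.disjoint_union_left, Finset.disjoint_union_left]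
    exact ⟨⟨hd (by rw [Prod.mk_inj]; omega), hd (by rw [Prod.mk_inj]; omega)⟩,
      hd (by rw [Prod.mk_inj]; omega)⟩

/-! ### The shapes of the double hook sums -/

theorem rowLen_ofRowLens_eq_getD (w : List ℕ) (hw : w.SortedGE) (i : ℕ) :
    (YoungDiagram.ofRowLens w hw).rowLen i = w.getD i 0 := by
  refine rowLen_eq_of_mem_iff fun j => ?_
  rw [YoungDiagram.mem_ofRowLens]
  by_cases h : i < w.length
  · simp [h]
  · simp [h]

theorem getD_replicate_two (p i : ℕ) : (List.replicate p 2).getD i 0 = if i < p then 2 else 0 := by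
  simp only [List.getD_eq_getElem?_getD, List.getElem?_replicate]
  split_ifs <;> rfl

theorem rowLen_shapeEven (m k i : ℕ) :
    (shapeEven m k).rowLen i = doubleHookRow k k (m - 2 - k) 0 i := by
  rw [shapeEven, rowLen_ofRowLens_eq_getD]
  match i with
  | 0 => rfl
  | 1 => rfl
  | i + 2 =>
    simp only [List.getD_cons_succ, getD_replicate_two, doubleHookRow]
    split_ifs <;> first | omega | contradiction

theorem rowLen_shapeOdd (m k i : ℕ) :
    (shapeOdd m k).rowLen i = doubleHookRow (k + 1) k (m - 2 - k) 0 i := by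
  rw [shapeOdd, rowLen_ofRowLens_eq_getD]
  match i with
  | 0 => rfl
  | 1 => rfl
  | i + 2 =>
    simp only [List.getD_cons_succ, getD_replicate_two, doubleHookRow]
    split_ifs <;> first | omega | contradiction

theorem SStar_two_mul (m : ℕ) :
    (SStar (2 * m) : ℚ) = ∑ k ∈ Finset.range (m - 1), doubleHookCount k k (m - 2 - k) 0 := by
  classical
  have hinj : Function.Injective (shapeEven m) := fun k l h => by
    have h0 := congrArg (fun μ => μ.rowLen 0) h
    simpa [rowLen_shapeEven, doubleHookRow] using h0
  rw [SStar, hookStar, if_pos (even_two_mul m), Nat.mul_div_cancel_left m two_pos,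
    Finset.sum_image hinj.injOn, Nat.cast_sum]
  exact Finset.sum_congr rfl fun k _ => numSYT_of_doubleHookRow le_rfl (rowLen_shapeEven m k)

theorem SStar_two_mul_add_one (m : ℕ) :
    (SStar (2 * m + 1) : ℚ) =
      ∑ k ∈ Finset.range (m - 1), doubleHookCount (k + 1) k (m - 2 - k) 0 := by
  classical
  have hinj : Function.Injective (shapeOdd m) := fun k l h => by
    have h0 := congrArg (fun μ => μ.rowLen 0) h
    simpa [rowLen_shapeOdd, doubleHookRow] using h0
  rw [SStar, hookStar, if_neg (by simp), show (2 * m + 1) / 2 = m by omega,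
    Finset.sum_image hinj.injOn, Nat.cast_sum]
  exact Finset.sum_congr rfl fun k _ =>
    numSYT_of_doubleHookRow (Nat.le_succ k) (rowLen_shapeOdd m k)

theorem doubleHookCount_even {m k : ℕ} (hk : k + 2 ≤ m) :
    doubleHookCount k k (m - 2 - k) 0 =
      ((2 * m)! : ℚ) /
        ((k ! : ℚ) * ((k + 1)! : ℚ) * ((m - 2 - k)! : ℚ) * ((m - 1 - k)! : ℚ) *
          ((m : ℚ) - 1) * (m : ℚ) ^ 2 * ((m : ℚ) + 1)) := by
  obtain ⟨p, rfl⟩ := Nat.exists_eq_add_of_le hk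
  rw [doubleHookCount, show k + 2 + p - 2 - k = p by omega, show k + 2 + p - 1 - k = p + 1 by omega,
    show k + k + 2 * p + 0 + 4 = 2 * (k + 2 + p) by ring, add_zero]
  push_cast
  congr 1 <;> ring

theorem doubleHookCount_odd {m k : ℕ} (hk : k + 2 ≤ m) :
    doubleHookCount (k + 1) k (m - 2 - k) 0 =
      ((2 * m + 1)! * 2 : ℚ) /
        ((k ! : ℚ) * ((k + 2)! : ℚ) * ((m - 2 - k)! : ℚ) * ((m - 1 - k)! : ℚ) *
          ((m : ℚ) - 1) * (m : ℚ) * ((m : ℚ) + 1) * ((m : ℚ) + 2)) := by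
  obtain ⟨p, rfl⟩ := Nat.exists_eq_add_of_le hk
  rw [doubleHookCount, show k + 2 + p - 2 - k = p by omega, show k + 2 + p - 1 - k = p + 1 by omega,
    show k + 1 + k + 2 * p + 0 + 4 = 2 * (k + 2 + p) + 1 by ring, add_zero]
  push_cast
  congr 1 <;> ring

/-- Vandermonde's identity, with the binomial coefficients written out. -/
theorem sum_range_one_div_factorial (n d : ℕ) :
    ∑ k ∈ Finset.range (n + 1),
        (1 : ℚ) / (k ! * (k + d)! * (n - k)! * (n + 1 - k)!) =
      (2 * n + d + 1).choose (n + 1) / (n ! * (n + d + 1)!) := by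
  have hV := Nat.add_choose_eq n (n + d + 1) (n + 1)
  rw [Finset.Nat.sum_antidiagonal_eq_sum_range_succ
    (fun i j => n.choose i * (n + d + 1).choose j), Finset.sum_range_succ,
    Nat.choose_succ_self, zero_mul, add_zero, show n + (n + d + 1) = 2 * n + d + 1 by ring] at hV
  rw [hV, Nat.cast_sum, Finset.sum_div]
  refine Finset.sum_congr rfl fun k hk => ?_
  have hk' := Finset.mem_range.1 hk
  rw [Nat.cast_mul, Nat.cast_choose ℚ (by omega), Nat.cast_choose ℚ (by omega),
    show n + d + 1 - (n + 1 - k) = k + d by omega]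
  field_simp

theorem sum_even_closed_form (n : ℕ) :
    1 / (((n + 2 : ℕ) : ℚ) * (((n + 2 : ℕ) : ℚ) + 1)) *
        (Nat.choose (2 * (n + 1)) (n + 1) : ℚ) * (Nat.choose (2 * (n + 2)) (n + 2) : ℚ) =
      ∑ k ∈ Finset.range (n + 1),
        ((2 * (n + 2))! : ℚ) /
          ((k ! : ℚ) * ((k + 1)! : ℚ) * ((n - k)! : ℚ) * ((n + 1 - k)! : ℚ) *
            (((n + 2 : ℕ) : ℚ) - 1) * ((n + 2 : ℕ) : ℚ) ^ 2 * (((n + 2 : ℕ) : ℚ) + 1)) := by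
  have hsum := sum_range_one_div_factorial n 1
  have hfac : ∀ k : ℕ, ((2 * (n + 2))! : ℚ) /
          ((k ! : ℚ) * ((k + 1)! : ℚ) * ((n - k)! : ℚ) * ((n + 1 - k)! : ℚ) *
            (((n + 2 : ℕ) : ℚ) - 1) * ((n + 2 : ℕ) : ℚ) ^ 2 * (((n + 2 : ℕ) : ℚ) + 1)) =
      ((2 * (n + 2))! : ℚ) / ((n + 1) * (n + 2) ^ 2 * (n + 3)) *
        (1 / (k ! * (k + 1)! * (n - k)! * (n + 1 - k)!)) := fun k => by
    push_cast
    rw [show (n : ℚ) + 2 - 1 = n + 1 by ring, show (n : ℚ) + 2 + 1 = n + 3 by ring]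
    field_simp
  simp only [hfac]
  rw [← Finset.mul_sum, hsum, show 2 * n + 1 + 1 = 2 * (n + 1) by ring,
    Nat.cast_choose ℚ (show n + 2 ≤ 2 * (n + 2) by omega),
    show 2 * (n + 2) - (n + 2) = n + 1 + 1 by omega, show n + 2 = n + 1 + 1 by ring]
  simp only [Nat.factorial_succ (n + 1), Nat.factorial_succ n]
  push_cast
  field_simp
  ring

theorem sum_odd_closed_form (n : ℕ) :
    1 / ((((n + 2 : ℕ) : ℚ) + 1) * (((n + 2 : ℕ) : ℚ) + 2)) *
        (Nat.choose (2 * (n + 2)) (n + 2) : ℚ) * (Nat.choose (2 * (n + 2) + 1) (n + 2) : ℚ) =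
      ∑ k ∈ Finset.range (n + 1),
        ((2 * (n + 2) + 1)! * 2 : ℚ) /
          ((k ! : ℚ) * ((k + 2)! : ℚ) * ((n - k)! : ℚ) * ((n + 1 - k)! : ℚ) *
            (((n + 2 : ℕ) : ℚ) - 1) * ((n + 2 : ℕ) : ℚ) * (((n + 2 : ℕ) : ℚ) + 1) *
            (((n + 2 : ℕ) : ℚ) + 2)) := by
  have hsum := sum_range_one_div_factorial n 2
  have hfac : ∀ k : ℕ, ((2 * (n + 2) + 1)! * 2 : ℚ) /
          ((k ! : ℚ) * ((k + 2)! : ℚ) * ((n - k)! : ℚ) * ((n + 1 - k)! : ℚ) *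
            (((n + 2 : ℕ) : ℚ) - 1) * ((n + 2 : ℕ) : ℚ) * (((n + 2 : ℕ) : ℚ) + 1) *
            (((n + 2 : ℕ) : ℚ) + 2)) =
      ((2 * (n + 2) + 1)! * 2 : ℚ) / ((n + 1) * (n + 2) * (n + 3) * (n + 4)) *
        (1 / (k ! * (k + 2)! * (n - k)! * (n + 1 - k)!)) := fun k => by
    push_cast
    rw [show (n : ℚ) + 2 - 1 = n + 1 by ring, show (n : ℚ) + 2 + 1 = n + 3 by ring,
      show (n : ℚ) + 2 + 2 = n + 4 by ring]
    field_simp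
  -- `binom(2m, m) = 2 binom(2m - 1, m - 1)`
  have hhalf : Nat.choose (2 * (n + 2)) (n + 2) = 2 * Nat.choose (2 * n + 2 + 1) (n + 1) := by
    rw [show 2 * (n + 2) = 2 * (n + 1) + 1 + 1 by ring, Nat.choose_succ_succ,
      Nat.choose_symm_half, ← two_mul, show 2 * n + 2 + 1 = 2 * (n + 1) + 1 by ring]
  simp only [hfac]
  rw [← Finset.mul_sum, hsum, hhalf,
    Nat.cast_choose ℚ (show n + 2 ≤ 2 * (n + 2) + 1 by omega),
    show 2 * (n + 2) + 1 - (n + 2) = n + 2 + 1 by omega, show n + 2 = n + 1 + 1 by ring]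
  simp only [Nat.factorial_succ (n + 1), Nat.factorial_succ n, Nat.factorial_succ (n + 1 + 1)]
  push_cast
  field_simp
  ring

theorem catalan_mul_catalan_closed_form (n : ℕ) :
    (catalan (n + 1) : ℚ) * (catalan (n + 2) : ℚ) =
      1 / (((n + 2 : ℕ) : ℚ) * (((n + 2 : ℕ) : ℚ) + 1)) *
        (Nat.choose (2 * (n + 1)) (n + 1) : ℚ) * (Nat.choose (2 * (n + 2)) (n + 2) : ℚ) := by
  have h1 := congrArg (Nat.cast (R := ℚ)) (succ_mul_catalan_eq_centralBinom (n + 1))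
  have h2 := congrArg (Nat.cast (R := ℚ)) (succ_mul_catalan_eq_centralBinom (n + 2))
  rw [Nat.centralBinom] at h1 h2
  rw [← h1, ← h2]
  push_cast
  field_simp
  ring

theorem catalan_sq_closed_form (n : ℕ) :
    (2 * ((n + 2 : ℕ) : ℚ) + 1) / (((n + 2 : ℕ) : ℚ) + 2) * (catalan (n + 2) : ℚ) ^ 2 =
      1 / ((((n + 2 : ℕ) : ℚ) + 1) * (((n + 2 : ℕ) : ℚ) + 2)) *
        (Nat.choose (2 * (n + 2)) (n + 2) : ℚ) * (Nat.choose (2 * (n + 2) + 1) (n + 2) : ℚ) := by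
  rw [cast_catalan, Nat.cast_choose ℚ (show n + 2 ≤ 2 * (n + 2) by omega),
    Nat.cast_choose ℚ (show n + 2 ≤ 2 * (n + 2) + 1 by omega),
    show 2 * (n + 2) - (n + 2) = n + 2 by omega,
    show 2 * (n + 2) + 1 - (n + 2) = n + 2 + 1 by omega, Nat.factorial_succ (2 * (n + 2)),
    Nat.factorial_succ (n + 2)]
  push_cast
  field_simp

end HookSums

theorem proposition3p2 (m : ℕ) (hm : 2 ≤ m) :
    (HookSums.S 4 0 (2 * m - 2) = catalan (m - 1) * catalan m ∧
      catalan (m - 1) * catalan m = HookSums.SStar (2 * m) ∧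
      (catalan (m - 1) : ℚ) * (catalan m : ℚ) =
        1 / ((m : ℚ) * ((m : ℚ) + 1)) *
          (Nat.choose (2 * m - 2) (m - 1) : ℚ) * (Nat.choose (2 * m) m : ℚ) ∧
      1 / ((m : ℚ) * ((m : ℚ) + 1)) *
          (Nat.choose (2 * m - 2) (m - 1) : ℚ) * (Nat.choose (2 * m) m : ℚ) =
        ∑ k ∈ Finset.range (m - 1),
          ((2 * m)! : ℚ) /
            ((k ! : ℚ) * ((k + 1)! : ℚ) * ((m - 2 - k)! : ℚ) * ((m - 1 - k)! : ℚ) *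
              ((m : ℚ) - 1) * (m : ℚ) ^ 2 * ((m : ℚ) + 1))) ∧
    ((2 * (m : ℚ) + 1) / ((m : ℚ) + 2) * (HookSums.S 4 0 (2 * m - 1) : ℚ) =
        (2 * (m : ℚ) + 1) / ((m : ℚ) + 2) * (catalan m : ℚ) ^ 2 ∧
      (2 * (m : ℚ) + 1) / ((m : ℚ) + 2) * (catalan m : ℚ) ^ 2 =
        (HookSums.SStar (2 * m + 1) : ℚ) ∧
      (2 * (m : ℚ) + 1) / ((m : ℚ) + 2) * (catalan m : ℚ) ^ 2 =
        1 / (((m : ℚ) + 1) * ((m : ℚ) + 2)) *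
          (Nat.choose (2 * m) m : ℚ) * (Nat.choose (2 * m + 1) m : ℚ) ∧
      1 / (((m : ℚ) + 1) * ((m : ℚ) + 2)) *
          (Nat.choose (2 * m) m : ℚ) * (Nat.choose (2 * m + 1) m : ℚ) =
        ∑ k ∈ Finset.range (m - 1),
          ((2 * m + 1)! * 2 : ℚ) /
            ((k ! : ℚ) * ((k + 2)! : ℚ) * ((m - 2 - k)! : ℚ) * ((m - 1 - k)! : ℚ) *
              ((m : ℚ) - 1) * (m : ℚ) * ((m : ℚ) + 1) * ((m : ℚ) + 2))) := by

  obtain ⟨n, rfl⟩ := Nat.exists_eq_add_of_le' hm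
  have hidx : ∀ k ∈ Finset.range (n + 2 - 1), k + 2 ≤ n + 2 := fun k hk => by
    have := Finset.mem_range.1 hk
    omega
  have hE : (HookSums.SStar (2 * (n + 2)) : ℚ) = _ :=
    (HookSums.SStar_two_mul (n + 2)).trans
      (Finset.sum_congr rfl fun k hk => HookSums.doubleHookCount_even (hidx k hk))
  have hO : (HookSums.SStar (2 * (n + 2) + 1) : ℚ) = _ :=
    (HookSums.SStar_two_mul_add_one (n + 2)).trans
      (Finset.sum_congr rfl fun k hk => HookSums.doubleHookCount_odd (hidx k hk))
  have hS0 := HookSums.S_four_zero_even (n + 1)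
  have hS1 := HookSums.S_four_zero_odd (n + 1)
  have hC0 := HookSums.catalan_mul_catalan_closed_form n
  have hC1 := HookSums.catalan_sq_closed_form n
  have hV0 := HookSums.sum_even_closed_form n
  have hV1 := HookSums.sum_odd_closed_form n
  simp only [show n + 2 - 1 = n + 1 by omega, show n + 2 - 2 = n by omega,
    show 2 * (n + 2) - 2 = 2 * (n + 1) by omega,
    show 2 * (n + 2) - 1 = 2 * (n + 1) + 1 by omega] at hE hO ⊢
  refine ⟨⟨hS0, ?_, hC0, hV0⟩, ?_, ?_, hC1, hV1⟩
  · have h := hC0.trans (hV0.trans hE.symm)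
    exact_mod_cast h
  · rw [hS1, Nat.cast_pow]
  · exact hC1.trans (hV1.trans hO.symm)
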